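/- **Setting.** Let $\Gamma\subset\mathbb R^2$ be a lattice with unit cell $\Omega$ of area $|\Omega|$, let $\Gamma^*=\{G: G\cdot R\in 2\pi\mathbb Z\ \forall R\in\Gamma\}$ be its reciprocal lattice, and let $g_1,g_2$ generate $\Gamma^*$. Let $H$ be a $\Gamma$-periodic single-particle Hamiltonian acting on functions $\mathbb R^2\to\mathbb C^{2N}$ ($N$ layers, two sublattices) with $2M$ exactly flat bands, indexed by $\mathcal N=\{1,\dots,2M\}$, with Bloch eigenfunctions $\psi_{nk}$: $H\psi_{nk}=E_n\psi_{nk}$, $\psi_{nk}(r+R)=e^{ik\cdot R}\psi_{nk}(r)$ for $R\in\Gamma$, and $\psi_{n(k+G)}=\psi_{nk}$ for $G\in\Gamma^*$. Assume that for each $k$ the periodic parts $u_{nk}(r)=e^{-ik\cdot r}\psi_{nk}(r)$ are orthonormal in $L^2(\Omega;\mathbb C^{2N})$, and let $\Pi(k)$ be the orthogonal projector of $L^2(\Omega;\mathbb C^{2N})$ onto $\operatorname{span}\{u_{nk}:n\in\mathcal N\}$. Let $$\mathcal K=\Big\{\tfrac{i}{n_x}g_1+\tfrac{j}{n_y}g_2: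 0\le i<n_x,\ 0\le j<n_y\Big\},\qquad N_k=n_xn_y .$$ Let $\hat f_{nk},\hat f_{nk}^\dagger$ ($n\in\mathcal N$, $k\in\mathcal K$) be the fermionic annihilation and creation operators on the Fock space with modes $\mathcal N\times\mathcal K$, extended to $k\in\mathcal K+\Gamma^*$ by $\hat f_{n(k+G)}=\hat f_{nk}$ for $G\in\Gamma^*$. With $\hat u_{nk}(G)=\int_\Omega e^{-iG\cdot r}u_{nk}(r)\,dr$, define for $k\in\mathcal K$ and $q'\in\mathcal K+\Gamma^*$ the form factor $$[\Lambda_k(q')]_{mn}=\frac1{|\Omega|}\sum_{G\in\Gamma^*}\langle \hat u_{mk}(G),\hat u_{n(k+q')}(G)\rangle,$$ the operators $$\hat\rho(q')=\sum_{k\in\mathcal K}\sum_{m,n\in\mathcal N}[\Lambda_k(q')]_{mn}\Big(\hat f^\dagger_{mk}\hat f_{n(k+q')}-\tfrac12\delta_{mn}\delta_{q'\in\Gamma^*}\Big),$$ and, for a radially symmetric function $\hat V:\mathbb R^2\to\mathbb R$ with $\hat V(q)>0$ for all $q$, the flat-band interacting (FBI) Hamiltonian $$\hat H_{\rm FBI}=\frac1{N_k|\Omega|}\sum_{q'\in\mathcal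 K+\Gamma^*}\hat V(q')\,\hat\rho(q')\hat\rho(-q'),$$ where the series is assumed to converge. A ground state is a normalized state of least energy. $\hat H_{\rm FBI}$ is *frustration-free* if it has a ground state $\Phi$ with $\langle\Phi|\hat V(q')\hat\rho(q')\hat\rho(-q')|\Phi\rangle=0$ for every $q'\in\mathcal K+\Gamma^*$. A *Hartree–Fock ground state* is a half-filled Slater determinant $\Psi=\hat b_1^\dagger\cdots\hat b_{MN_k}^\dagger|{\rm vac}\rangle$, where $\hat b_i^\dagger=\sum_{n,k}\Xi_{ni}(k)\hat f_{nk}^\dagger$ and $\sum_{n,k}\overline{\Xi_{ni}(k)}\,\Xi_{nj}(k)=\delta_{ij}$, that is a ground state of $\hat H_{\rm FBI}$. Its 1-RDM has the blocks $[P(k,k')]_{nm}=\langle\Psi|\hat f^\dagger_{mk'}\hat f_{nk}|\Psi\rangle$, $k,k'\in\mathcal K+\Gamma^*$. *Connectivity assumption on the grid:* for all $k,k'\in\mathcal K$ there is a finite sequence $k=k_1,\dots,k_L=k'$ in $\mathcal K$ with $\|\Pi(k_{i+1})-\Pi(k_i)\|<1$ for $1\le i<L$. **Proposition (generalized ferromagnetism).**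 Suppose that $\hat H_{\rm FBI}$ is frustration-free and that $\mathcal K$ satisfies the connectivity assumption. Then there are invertible $2M\times 2M$ matrices $B_k(q')$ ($k\in\mathcal K$, $q'\in\mathbb R^2$), not depending on the state, such that for the 1-RDM $P$ of every Hartree–Fock ground state, all $k_1,k_2\in\mathcal K$ and all $q'\in\mathcal K+\Gamma^*$, $$P(k_1+q',k_2+q')=B_{k_1}(q')^{-1}\,P(k_1,k_2)\,B_{k_2}(q').$$ Hence one block determines all blocks shifted by the same momentum: if $P$ and $P'$ are 1-RDMs of Hartree–Fock ground states of $\hat H_{\rm FBI}$ and $P(k_1,k_2)=P'(k_1,k_2)$ for some $k_1,k_2\in\mathcal K$, then $P(k_1+q',k_2+q')=P'(k_1+q',k_2+q')$ for all $q'\in\mathcal K+\Gamma^*$. -/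

import Mathlib

open MeasureTheory
open scoped BigOperators InnerProductSpace

noncomputable section

namespace FBI

/-! ## Fermionic Fock space over finitely many modes -/

section FockSpace

variable {ι : Type} [Fintype ι] [LinearOrder ι]

/-- Fermionic Fock space over the modes `ι`, with the orthonormal basis of occupation-number
states indexed by the sets of occupied modes. -/
abbrev Fock (ι : Type) [Fintype ι] : Type := EuclideanSpace ℂ (Finset ι)

/-- The annihilation operator `c i`: on occupation-number states,
`c i |S⟩ = (-1) ^ #{j ∈ S | j < i} |S \ {i}⟩` if `i ∈ S`, and `c i |S⟩ = 0` otherwise. -/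
def annihilate (i : ι) : Fock ι →L[ℂ] Fock ι :=
  LinearMap.toContinuousLinearMap
    { toFun := fun Φ => WithLp.toLp 2 fun S : Finset ι =>
        if i ∈ S then 0 else (-1 : ℂ) ^ (S.filter (fun j => j < i)).card * Φ (insert i S)
      map_add' := by
        intro Φ Φ'
        ext S
        by_cases h : i ∈ S <;> simp [h, mul_add]
      map_smul' := by
        intro z Φ
        ext S
        by_cases h : i ∈ S
        · simp [h]
        · simp [h]
          ring }

/-- The vacuum state. -/
def vacuum (ι : Type) [Fintype ι] [LinearOrder ι] : Fock ι := EuclideanSpace.single ∅ 1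

/-- A many-body ground state of `H`: a normalised state of least energy. -/
def IsGroundState (H : Fock ι →L[ℂ] Fock ι) (Φ : Fock ι) : Prop :=
  ‖Φ‖ = 1 ∧ ∀ Φ' : Fock ι, ‖Φ'‖ = 1 → (⟪Φ, H Φ⟫_ℂ).re ≤ (⟪Φ', H Φ'⟫_ℂ).re

end FockSpace

/-! ## Moiré lattice, flat bands and momentum grid -/

/-- The plane `ℝ²`, used for positions and for momenta. -/
abbrev Plane : Type := EuclideanSpace ℝ (Fin 2)

/-- `ℂ^{2N}`, with components indexed by sublattice (two values) and layer (`N` values). -/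
abbrev Spinor (N : ℕ) : Type := EuclideanSpace ℂ (Fin 2 × Fin N)

/-- The reciprocal lattice `Γ* = {G | G · R ∈ 2πℤ for all R ∈ Γ}` of `Γ`. -/
def reciprocal (Γ : AddSubgroup Plane) : AddSubgroup Plane where
  carrier := {G | ∀ R ∈ Γ, ∃ m : ℤ, ⟪G, R⟫_ℝ = 2 * Real.pi * m}
  zero_mem' := fun R _ => ⟨0, by simp⟩
  add_mem' := by
    intro G G' hG hG' R hR
    obtain ⟨m, hm⟩ := hG R hR
    obtain ⟨m', hm'⟩ := hG' R hR
    exact ⟨m + m', by rw [inner_add_left, hm, hm']; push_cast; ring⟩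
  neg_mem' := by
    intro G hG R hR
    obtain ⟨m, hm⟩ := hG R hR
    exact ⟨-m, by rw [inner_neg_left, hm]; push_cast; ring⟩

/-- A lattice `Γ = ℤ a₀ + ℤ a₁` in the plane with a pair `g₀, g₁` of generating vectors of its
reciprocal lattice. -/
structure MoireLattice where
  a : Module.Basis (Fin 2) ℝ Plane
  g : Module.Basis (Fin 2) ℝ Plane
  closure_g : AddSubgroup.closure (Set.range g) =
    reciprocal (AddSubgroup.closure (Set.range a))

namespace MoireLattice

variable (L : MoireLattice)

/-- The moiré lattice `Γ`. -/
def lattice : AddSubgroup Plane := AddSubgroup.closure (Set.range L.a)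

/-- The moiré reciprocal lattice `Γ*`. -/
def dual : AddSubgroup Plane := reciprocal L.lattice

/-- The real space unit cell `Ω = {s a₀ + t a₁ | 0 ≤ s, t < 1}`. -/
def cell : Set Plane := ZSpan.fundamentalDomain L.a

/-- The area `|Ω|`. -/
def area : ℝ := (volume : Measure Plane).real L.cell

/-- The point `(i / nx) g₀ + (j / ny) g₁` of the momentum grid. -/
def gridPoint {nx ny : ℕ} (κ : Fin nx × Fin ny) : Plane :=
  ((κ.1 : ℝ) / (nx : ℝ)) • L.g 0 + ((κ.2 : ℝ) / (ny : ℝ)) • L.g 1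

/-- The momentum grid `𝒦`. -/
def grid (nx ny : ℕ) : Set Plane :=
  Set.range fun κ : Fin nx × Fin ny => L.gridPoint κ

/-- The set of momenta `𝒦 + Γ*`. -/
def momenta (nx ny : ℕ) : Set Plane :=
  {q | ∃ k ∈ L.grid nx ny, ∃ G ∈ L.dual, q = k + G}

end MoireLattice

/-- `r ↦ exp(-i k · r) ψ(r)`. -/
def blochPart {N : ℕ} (k : Plane) (ψ : Plane → Spinor N) (r : Plane) : Spinor N :=
  Complex.exp (-Complex.I * (⟪k, r⟫_ℝ : ℂ)) • ψ r

/-- A `Γ`-periodic single-particle Hamiltonian `H` for `N` layers with `2M` exactly flat bands,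
and its flat-band Bloch eigenfunctions `ψ n k`, with `Γ`-periodic parts
`u n k = exp(-i k · r) ψ n k` that are orthonormal over the unit cell. -/
structure FlatBands (L : MoireLattice) (N M : ℕ) where
  /-- the single-particle Hamiltonian -/
  H : (Plane → Spinor N) →ₗ.[ℂ] (Plane → Spinor N)
  /-- `H` commutes with the translations by `Γ` -/
  H_periodic : ∀ R ∈ L.lattice, ∀ f : H.domain,
    ∃ h : (fun r => (f : Plane → Spinor N) (r + R)) ∈ H.domain,
      H ⟨_, h⟩ = fun r => H f (r + R)
  /-- the Bloch eigenfunctions -/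
  ψ : Fin (2 * M) → Plane → Plane → Spinor N
  ψ_mem : ∀ n k, ψ n k ∈ H.domain
  /-- the energies of the flat bands, which do not depend on `k` -/
  E : Fin (2 * M) → ℝ
  eigen : ∀ n k, H ⟨ψ n k, ψ_mem n k⟩ = (E n : ℂ) • ψ n k
  /-- quasi-periodicity in position -/
  bloch : ∀ n k, ∀ R ∈ L.lattice, ∀ r,
    ψ n k (r + R) = Complex.exp (Complex.I * (⟪k, R⟫_ℝ : ℂ)) • ψ n k r
  /-- periodicity in momentum -/
  ψ_add_dual : ∀ n k, ∀ G ∈ L.dual, ψ n (k + G) = ψ n k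
  memLp : ∀ n k, MemLp (blochPart k (ψ n k)) 2 (volume.restrict L.cell)
  orthonormal : ∀ m n k,
    (∫ r in L.cell, ⟪blochPart k (ψ m k) r, blochPart k (ψ n k) r⟫_ℂ) = if m = n then 1 else 0

/-- The modes `(n, k)`, with `k ∈ 𝒦` given by its index, in lexicographic order. -/
abbrev Mode (M nx ny : ℕ) : Type := Fin (2 * M) ×ₗ (Fin nx ×ₗ Fin ny)

namespace FlatBands

variable {L : MoireLattice} {N M : ℕ} (S : FlatBands L N M)

/-- The periodic Bloch function `u n k`. -/
def u (n : Fin (2 * M)) (k : Plane) : Plane → Spinor N := blochPart k (S.ψ n k)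

/-- The Fourier coefficient `û n k (G) = ∫_Ω exp(-i G · r) u n k (r) dr`. -/
def uHat (n : Fin (2 * M)) (k G : Plane) : Spinor N :=
  ∫ r in L.cell, Complex.exp (-Complex.I * (⟪G, r⟫_ℝ : ℂ)) • S.u n k r

/-- The form factor `Λ_k(q')`. -/
def formFactor (k q : Plane) : Matrix (Fin (2 * M)) (Fin (2 * M)) ℂ :=
  Matrix.of fun m n =>
    ((1 / L.area : ℝ) : ℂ) * ∑' G : L.dual, ⟪S.uHat m k G, S.uHat n (k + q) G⟫_ℂ

/-- `u n k` as an element of `L²(Ω; ℂ^{2N})`. -/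
def uLp (n : Fin (2 * M)) (k : Plane) : Lp (Spinor N) 2 (volume.restrict L.cell) :=
  (S.memLp n k).toLp

/-- The orthogonal projector `Π(k)` of `L²(Ω; ℂ^{2N})` onto the span of the periodic flat-band
functions `u n k`. -/
def proj (k : Plane) : Lp (Spinor N) 2 (volume.restrict L.cell) →L[ℂ]
    Lp (Spinor N) 2 (volume.restrict L.cell) :=
  haveI : FiniteDimensional ℂ (Submodule.span ℂ (Set.range fun n => S.uLp n k)) :=
    FiniteDimensional.span_of_finite ℂ (Set.finite_range _)
  (Submodule.span ℂ (Set.range fun n => S.uLp n k)).starProjection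

/-- The connectivity assumption on the grid: any two points of `𝒦` are joined by a finite
sequence `p 0, …, p l` in `𝒦` along which consecutive projectors are at distance less than 1. -/
def GridConnected (nx ny : ℕ) : Prop :=
  ∀ k ∈ L.grid nx ny, ∀ k' ∈ L.grid nx ny, ∃ (l : ℕ) (p : ℕ → Plane),
    p 0 = k ∧ p l = k' ∧ (∀ i ≤ l, p i ∈ L.grid nx ny) ∧
      ∀ i < l, ‖S.proj (p (i + 1)) - S.proj (p i)‖ < 1

end FlatBands

/-! ## The flat-band interacting Hamiltonian -/

section Hamiltonian

variable (L : MoireLattice) {N M : ℕ} (nx ny : ℕ)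

open Classical in
/-- The band annihilation operator `f n k` for `k ∈ 𝒦 + Γ*`: that of the mode `(n, k̃)`, where `k̃`
is the unique point of `𝒦` with `k - k̃ ∈ Γ*`. (For other `k` it is set to `0`.) -/
def bandAnn (n : Fin (2 * M)) (k : Plane) : Fock (Mode M nx ny) →L[ℂ] Fock (Mode M nx ny) :=
  if h : ∃ κ : Fin nx × Fin ny, k - L.gridPoint κ ∈ L.dual then
    annihilate (toLex (n, toLex h.choose))
  else 0

/-- The band creation operator `f† n k`. -/
def bandCre (n : Fin (2 * M)) (k : Plane) : Fock (Mode M nx ny) →L[ℂ] Fock (Mode M nx ny) :=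
  ContinuousLinearMap.adjoint (bandAnn L nx ny n k)

variable {L}

open Classical in
/-- The operator `ρ̂(q')`. -/
def rhoHat (S : FlatBands L N M) (q : Plane) : Fock (Mode M nx ny) →L[ℂ] Fock (Mode M nx ny) :=
  ∑ κ : Fin nx × Fin ny, ∑ m : Fin (2 * M), ∑ n : Fin (2 * M),
    S.formFactor (L.gridPoint κ) q m n •
      (bandCre L nx ny m (L.gridPoint κ) * bandAnn L nx ny n (L.gridPoint κ + q)
        - (if m = n ∧ q ∈ L.dual then (1 / 2 : ℂ) else 0) • 1)

/-- The term `V̂(q') ρ̂(q') ρ̂(-q')` of the Hamiltonian. -/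
def fbiTerm (S : FlatBands L N M) (Vhat : Plane → ℝ) (q : Plane) :
    Fock (Mode M nx ny) →L[ℂ] Fock (Mode M nx ny) :=
  (Vhat q : ℂ) • (rhoHat nx ny S q * rhoHat nx ny S (-q))

/-- The FBI Hamiltonian
`(N_k |Ω|)⁻¹ ∑_{q' ∈ 𝒦 + Γ*} V̂(q') ρ̂(q') ρ̂(-q')`, where `N_k = nx * ny`. -/
def fbiHamiltonian (S : FlatBands L N M) (Vhat : Plane → ℝ) :
    Fock (Mode M nx ny) →L[ℂ] Fock (Mode M nx ny) :=
  ((1 / ((nx * ny : ℕ) * L.area) : ℝ) : ℂ) •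
    ∑' q : L.momenta nx ny, fbiTerm nx ny S Vhat q

/-- The FBI Hamiltonian is frustration-free: some ground state has energy zero for each of its
(positive semidefinite) terms. -/
def IsFrustrationFree (S : FlatBands L N M) (Vhat : Plane → ℝ) : Prop :=
  ∃ Φ : Fock (Mode M nx ny), IsGroundState (fbiHamiltonian nx ny S Vhat) Φ ∧
    ∀ q ∈ L.momenta nx ny, ⟪Φ, fbiTerm nx ny S Vhat q Φ⟫_ℂ = 0

variable (L)

/-- The creation operator `∑_{n,k} Ξ_{n}(k) f† n k` of an orbital. -/
def orbitalCre (ξ : Fin (2 * M) → Fin nx × Fin ny → ℂ) :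
    Fock (Mode M nx ny) →L[ℂ] Fock (Mode M nx ny) :=
  ∑ n : Fin (2 * M), ∑ κ : Fin nx × Fin ny, ξ n κ • bandCre L nx ny n (L.gridPoint κ)

/-- `Ψ` is a half-filled Slater determinant `b†_1 ⋯ b†_{M N_k} |vac⟩` with orthonormal orbitals. -/
def IsSlater (Ψ : Fock (Mode M nx ny)) : Prop :=
  ∃ Ξ : Fin (M * (nx * ny)) → Fin (2 * M) → Fin nx × Fin ny → ℂ,
    (∀ i j, (∑ n, ∑ κ, starRingEnd ℂ (Ξ i n κ) * Ξ j n κ) = if i = j then 1 else 0) ∧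
      Ψ = (List.ofFn fun i => orbitalCre L nx ny (Ξ i)).prod (vacuum (Mode M nx ny))

/-- The block `P(k, k')` of the 1-RDM of `Ψ`: `[P(k, k')]_{nm} = ⟨Ψ| f†_{m k'} f_{n k} |Ψ⟩`. -/
def rdm (Ψ : Fock (Mode M nx ny)) (k k' : Plane) : Matrix (Fin (2 * M)) (Fin (2 * M)) ℂ :=
  Matrix.of fun n m => ⟪Ψ, bandCre L nx ny m k' (bandAnn L nx ny n k Ψ)⟫_ℂ

variable {L}

/-- A Hartree-Fock ground state: a half-filled Slater determinant that is a ground state of the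
FBI Hamiltonian. -/
def IsHartreeFockGroundState (S : FlatBands L N M) (Vhat : Plane → ℝ)
    (Ψ : Fock (Mode M nx ny)) : Prop :=
  IsSlater L nx ny Ψ ∧ IsGroundState (fbiHamiltonian nx ny S Vhat) Ψ

end Hamiltonian

end FBI

end

/-! Since `ρ̂(q)` and `ρ̂(-q)` are adjoint (`adjoint_rhoHat`), every term of the Hamiltonian is
positive semidefinite. Frustration-freeness puts the least energy at zero, and `V̂ > 0` then forces
every ground state to be annihilated by all `ρ̂(q)` (`rhoHat_apply_eq_zero`). In such a state the
commutator of `ρ̂(q)` with a hop `f†f` has expectation zero. This commutator is again one-body, so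
the result is a linear relation on the 1-RDM (`formFactor_mul_rdm`): `Λ_{k₁}(q) P(k₁+q, k₂+q) =
P(k₁, k₂) Λ_{k₂}(q)`.

If all `Λ_k(q)` were invertible they would serve as `B_k(q)`. By Parseval they are the overlap
matrices of the periodic Bloch functions, and they are invertible when the band projectors are at
distance less than one (`isUnit_formFactor`), which may fail for a long shift. Multiplying form
factors along a connecting path from `k` to `k + q` modulo `Γ*` gives a family satisfying the same
relation and invertible at `k` (`exists_intertwiner_isUnit`), though perhaps singular at other grid
points. One family must serve both `k₁` and `k₂`. The relation is linear in the family, so its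
solutions form a vector space, and a generic combination of the path products is invertible on the
whole grid (`exists_mem_forall_isUnit`). -/

noncomputable section

namespace FBI

/-! ### Canonical anticommutation relations. -/

section CAR

variable {ι : Type} [Fintype ι] [LinearOrder ι]

theorem annihilate_apply (i : ι) (Φ : Fock ι) (S : Finset ι) :
    annihilate i Φ S =
      if i ∈ S then 0 else (-1 : ℂ) ^ (S.filter (fun j => j < i)).card * Φ (insert i S) := rfl

omit [Fintype ι] in
theorem filter_erase_lt (i : ι) (S : Finset ι) :
    (S.erase i).filter (fun j => j < i) = S.filter (fun j => j < i) := by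
  ext j; simp only [Finset.mem_filter, Finset.mem_erase]
  exact ⟨fun h => ⟨h.1.2, h.2⟩, fun h => ⟨⟨h.2.ne, h.1⟩, h.2⟩⟩

/-- The adjoint of `annihilate i`, in the occupation-number basis. -/
theorem adjoint_annihilate_apply (i : ι) (Φ : Fock ι) (S : Finset ι) :
    ContinuousLinearMap.adjoint (annihilate i) Φ S =
      if i ∈ S then (-1 : ℂ) ^ (S.filter (fun j => j < i)).card * Φ (S.erase i) else 0 := by
  have h := ContinuousLinearMap.adjoint_inner_right (annihilate i)
    (EuclideanSpace.single S (1 : ℂ)) Φ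
  rw [EuclideanSpace.inner_single_left, map_one, one_mul] at h
  rw [h]
  have hS : annihilate i (EuclideanSpace.single S (1 : ℂ)) =
      if i ∈ S then EuclideanSpace.single (S.erase i)
        ((-1 : ℂ) ^ (S.filter (fun j => j < i)).card) else 0 := by
    ext T
    rw [annihilate_apply]
    by_cases hi : i ∈ S
    · rw [if_pos hi]
      by_cases hT : i ∈ T
      · have : T ≠ S.erase i := by rintro rfl; simp at hT
        simp [hT, this]
      · by_cases hTS : T = S.erase i
        · subst hTS
          simp [Finset.insert_erase hi, filter_erase_lt]
        · have : insert i T ≠ S := by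
            rintro rfl; exact hTS (Finset.erase_insert hT).symm
          simp [hT, hTS, this]
    · have : insert i T ≠ S := by rintro rfl; simp at hi
      simp [hi, this]
  rw [hS]
  split_ifs
  · rw [EuclideanSpace.inner_single_left]; simp
  · simp

omit [Fintype ι] in
-- A particle in mode `i` changes the ordering sign of mode `j` exactly when `i` precedes `j`; all
-- the anticommutation signs come from this.
theorem neg_one_pow_card_filter_insert {i j : ι} {S : Finset ι} (hi : i ∉ S) :
    (-1 : ℂ) ^ ((insert i S).filter (fun l => l < j)).card =
      (if i < j then -1 else 1) * (-1 : ℂ) ^ (S.filter (fun l => l < j)).card := by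
  rw [Finset.filter_insert]
  split_ifs
  · rw [Finset.card_insert_of_notMem (by simp [hi]), pow_succ]; ring
  · ring

theorem annihilate_anticomm (i j : ι) :
    annihilate i * annihilate j = -(annihilate j * annihilate i) := by
  ext Φ S
  simp only [mul_apply_eq_comp, neg_apply, PiLp.neg_apply,
    annihilate_apply]
  by_cases hij : i = j
  · subst hij; simp
  by_cases hi : i ∈ S
  · simp [hi]
  by_cases hj : j ∈ S
  · simp [hj]
  have hij' : j ≠ i := fun h => hij h.symm
  simp only [hi, hj, hij, hij', Finset.mem_insert, or_self, if_false,
    neg_one_pow_card_filter_insert, not_false_eq_true, Finset.insert_comm i j]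
  rcases lt_or_gt_of_ne hij with h | h
  · simp [h, h.not_gt]; ring
  · simp [h, h.not_gt]; ring

theorem annihilate_mul_adjoint (i j : ι) :
    annihilate i * ContinuousLinearMap.adjoint (annihilate j) =
      (if i = j then (1 : ℂ) else 0) • 1 -
        ContinuousLinearMap.adjoint (annihilate j) * annihilate i := by
  ext Φ S
  simp only [mul_apply_eq_comp, sub_apply, PiLp.sub_apply,
    smul_apply, PiLp.smul_apply, one_apply_eq_self,
    annihilate_apply, adjoint_annihilate_apply]
  by_cases hij : i = j
  · subst hij
    by_cases hi : i ∈ S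
    · have h2 : (-1 : ℂ) ^ (S.filter (fun j => j < i)).card *
          (-1 : ℂ) ^ (S.filter (fun j => j < i)).card = 1 := by
        rw [← mul_pow]; simp
      simp [hi, filter_erase_lt, Finset.insert_erase hi, ← mul_assoc, h2]
    · have h2 : (-1 : ℂ) ^ (S.filter (fun j => j < i)).card *
          (-1 : ℂ) ^ (S.filter (fun j => j < i)).card = 1 := by
        rw [← mul_pow]; simp
      simp [hi, neg_one_pow_card_filter_insert hi, ← mul_assoc, h2]
  have hij' : j ≠ i := fun h => hij h.symm
  by_cases hi : i ∈ S
  · simp [hi, hij]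
  by_cases hj : j ∈ S
  -- Removing `j` refers all signs to a set containing neither mode; what remains is one relative
  -- sign, decided by the order of `i` and `j`.
  · obtain ⟨T, hT, rfl⟩ : ∃ T, j ∉ T ∧ insert j T = S :=
      ⟨S.erase j, by simp, Finset.insert_erase hj⟩
    have hiT : i ∉ T := fun h => hi (by simp [h])
    have e : (insert i (insert j T)).erase j = insert i T := by
      rw [Finset.insert_comm, Finset.erase_insert (by simp [hT, hij'])]
    simp only [hi, hij, hij', hT, hiT, Finset.mem_insert, or_true, or_false, if_true,
      if_false, e, Finset.erase_insert, not_false_eq_true, neg_one_pow_card_filter_insert,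
      lt_irrefl, zero_smul, zero_sub]
    rcases lt_or_gt_of_ne hij with h | h
    · simp [h, h.not_gt]; ring
    · simp [h, h.not_gt]; ring
  · simp [hi, hj, hij, hij']

theorem adjoint_annihilate_anticomm (i j : ι) :
    ContinuousLinearMap.adjoint (annihilate i) * ContinuousLinearMap.adjoint (annihilate j) =
      -(ContinuousLinearMap.adjoint (annihilate j) *
        ContinuousLinearMap.adjoint (annihilate i)) := by
  have h := congrArg ContinuousLinearMap.adjoint (annihilate_anticomm j i)
  rw [map_neg] at h
  simpa only [← ContinuousLinearMap.star_eq_adjoint, star_mul] using h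

/-- Normal ordering both products leaves the same quartic term, since two anticommutations cancel in
sign; only one contraction from each product survives. Hence one-body operators are closed under
commutators. -/
theorem commutator_hop (i j m n : ι) :
    (ContinuousLinearMap.adjoint (annihilate i) * annihilate j) *
        (ContinuousLinearMap.adjoint (annihilate m) * annihilate n) -
      (ContinuousLinearMap.adjoint (annihilate m) * annihilate n) *
        (ContinuousLinearMap.adjoint (annihilate i) * annihilate j) =
      (if j = m then (1 : ℂ) else 0) • (ContinuousLinearMap.adjoint (annihilate i) * annihilate n) -
      (if n = i then (1 : ℂ) else 0) •
        (ContinuousLinearMap.adjoint (annihilate m) * annihilate j) := by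
  have h1 := annihilate_mul_adjoint j m
  have h2 := annihilate_mul_adjoint n i
  have h3 := adjoint_annihilate_anticomm i m
  have h4 := annihilate_anticomm j n
  generalize annihilate j = aj at *
  generalize annihilate n = an at *
  generalize ContinuousLinearMap.adjoint (annihilate i) = ci at *
  generalize ContinuousLinearMap.adjoint (annihilate m) = cm at *
  have e1 : ci * aj * (cm * an) = ci * (aj * cm) * an := by simp only [mul_assoc]
  have e2 : cm * an * (ci * aj) = cm * (an * ci) * aj := by simp only [mul_assoc]
  have e3 : ci * (cm * aj) * an = cm * (ci * an) * aj := by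
    calc ci * (cm * aj) * an = (ci * cm) * (aj * an) := by simp only [mul_assoc]
      _ = cm * (ci * an) * aj := by rw [h3, h4]; simp only [neg_mul_neg, mul_assoc]
  rw [e1, e2, h1, h2, mul_sub, sub_mul, mul_sub, sub_mul, e3]
  simp

end CAR

/-! ### Parseval's identity on the unit cell, by transfer to the unit torus. -/

section Parseval

attribute [local instance] instMeasureSpaceUnitAddCircle

variable (L : MoireLattice)

theorem MoireLattice.volume_cell_ne_zero : (volume : Measure Plane) L.cell ≠ 0 :=
  ZSpan.measure_fundamentalDomain_ne_zero _

theorem MoireLattice.volume_cell_ne_top : (volume : Measure Plane) L.cell ≠ ⊤ :=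
  (ZSpan.fundamentalDomain_isBounded L.a).measure_lt_top.ne

theorem MoireLattice.area_pos : 0 < L.area :=
  ENNReal.toReal_pos L.volume_cell_ne_zero L.volume_cell_ne_top

instance : IsFiniteMeasure ((volume : Measure Plane).restrict L.cell) :=
  ⟨by simpa using L.volume_cell_ne_top.lt_top⟩

/-- The Lebesgue measure of a unit cell corresponds, in lattice coordinates and up to
normalisation, to that of the unit torus. -/
theorem MoireLattice.exists_measurePreserving_torus :
    ∃ s : UnitAddTorus (Fin 2) → Plane,
      MeasurePreserving s volume
        (((volume : Measure Plane) L.cell)⁻¹ • (volume : Measure Plane).restrict L.cell) ∧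
      ∀ t i, ((L.a.repr (s t) i : ℝ) : UnitAddCircle) = t i := by
  let e : Plane ≃L[ℝ] (Fin 2 → ℝ) := L.a.equivFun.toContinuousLinearEquiv
  have he : ∀ x i, L.a.repr (e.symm x) i = x i := fun x i => by
    have := congrFun (e.apply_symm_apply x) i
    simpa [e] using this
  let box : Set (Fin 2 → ℝ) := {x | ∀ i, x i ∈ Set.Ioc (0 : ℝ) (0 + 1)}
  have hbox : box = Set.univ.pi fun _ => Set.Ioc (0 : ℝ) 1 := by
    ext x; simp [box]
  have hboxm : MeasurableSet box := by
    rw [hbox]; exact MeasurableSet.univ_pi fun _ => measurableSet_Ioc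
  have h1 := UnitAddTorus.measurePreserving_equivPiIoc (d := Fin 2) (fun _ => 0)
  have h2 : MeasurePreserving (Subtype.val : box → Fin 2 → ℝ)
      (Measure.comap Subtype.val volume) (volume.restrict box) :=
    ⟨measurable_subtype_coe, map_comap_subtype_coe hboxm _⟩
  have h3 : (volume : Measure (Fin 2 → ℝ)).restrict box =
      volume.restrict (e.symm ⁻¹' L.cell) := by
    -- The torus chart takes boxes closed on the right, the cell is closed on the left; the two
    -- differ by a null set.
    apply Measure.restrict_congr_set
    have hc : e.symm ⁻¹' L.cell = Set.univ.pi fun _ => Set.Ico (0 : ℝ) 1 := by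
      ext x
      simp only [Set.mem_preimage, MoireLattice.cell, ZSpan.mem_fundamentalDomain, he,
        Set.mem_univ_pi]
    rw [hbox, hc]
    exact Measure.univ_pi_Ioc_ae_eq_Icc.trans Measure.univ_pi_Ico_ae_eq_Icc.symm
  have hem : Measurable e.symm := e.symm.continuous.measurable
  have hcell : MeasurableSet L.cell := ZSpan.fundamentalDomain_measurableSet _
  have h4 : Measure.map e.symm ((volume : Measure (Fin 2 → ℝ)).restrict (e.symm ⁻¹' L.cell)) =
      (Measure.map e.symm (volume : Measure (Fin 2 → ℝ))).restrict L.cell :=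
    (Measure.restrict_map hem hcell).symm
  have : (Measure.map e.symm (volume : Measure (Fin 2 → ℝ))).IsAddHaarMeasure :=
    ContinuousLinearEquiv.isAddHaarMeasure_map _ _
  obtain ⟨c, hc⟩ : ∃ c : NNReal, Measure.map e.symm (volume : Measure (Fin 2 → ℝ)) =
      c • (volume : Measure Plane) := ⟨_, Measure.isAddLeftInvariant_eq_smul _ _⟩
  have hsm : Measurable (fun t : UnitAddTorus (Fin 2) =>
      e.symm (UnitAddTorus.measurableEquivPiIoc (fun _ => 0) t).1) :=
    hem.comp (measurable_subtype_coe.comp (MeasurableEquiv.measurable _))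
  have hmap : Measure.map (fun t : UnitAddTorus (Fin 2) =>
      e.symm (UnitAddTorus.measurableEquivPiIoc (fun _ => 0) t).1) volume =
        c • (volume : Measure Plane).restrict L.cell := by
    have := (h2.comp h1).map_eq
    rw [h3] at this
    rw [← Measure.restrict_smul, ← hc, ← h4, ← this, Measure.map_map hem (h2.comp h1).measurable]
    rfl
  -- The Haar constant is fixed by total mass: the torus has mass one, so `c` times the area is one.
  have hcv : ((volume : Measure Plane) L.cell)⁻¹ = c := by
    have huniv : (volume : Measure (UnitAddTorus (Fin 2))) Set.univ = 1 := by
      have h5 : (volume : Measure UnitAddCircle) Set.univ = 1 :=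
        measure_univ (μ := AddCircle.haarAddCircle)
      rw [← Set.pi_univ Set.univ]
      have : SigmaFinite (volume : Measure UnitAddCircle) :=
        inferInstanceAs (SigmaFinite AddCircle.haarAddCircle)
      erw [volume_pi_pi]
      simp [h5]
    have := congrArg (fun μ => μ Set.univ) hmap
    simp only [Measure.map_apply hsm MeasurableSet.univ, Set.preimage_univ, huniv,
      Measure.smul_apply, Measure.restrict_apply_univ] at this
    refine (ENNReal.eq_inv_of_mul_eq_one_left ?_).symm
    rw [this]; rfl
  refine ⟨_, ⟨hsm, ?_⟩, ?_⟩
  · rw [hmap, hcv]; rfl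
  · intro t i
    rw [he]
    have := (UnitAddTorus.measurableEquivPiIoc (ι := Fin 2) (fun _ => 0)).symm_apply_apply t
    rw [UnitAddTorus.coe_symm_measurableEquivPiIoc_apply] at this
    exact congrFun this i

/-- Reciprocal lattice vectors are the vectors with inner products in `2πℤ` with the basis. -/
theorem MoireLattice.exists_dual_equiv :
    ∃ e : (Fin 2 → ℤ) ≃ L.dual, ∀ n i, ⟪(e n : Plane), L.a i⟫_ℝ = 2 * Real.pi * n i := by
  have hmem : ∀ G : Plane, (∀ i, ∃ m : ℤ, ⟪G, L.a i⟫_ℝ = 2 * Real.pi * m) → G ∈ L.dual := by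
    intro G hG R hR
    induction hR using AddSubgroup.closure_induction with
    | mem x hx => obtain ⟨i, rfl⟩ := hx; exact hG i
    | zero => exact ⟨0, by simp⟩
    | add x y _ _ hx hy =>
      obtain ⟨m, hm⟩ := hx
      obtain ⟨m', hm'⟩ := hy
      exact ⟨m + m', by rw [inner_add_right, hm, hm']; push_cast; ring⟩
    | neg x _ hx =>
      obtain ⟨m, hm⟩ := hx
      exact ⟨-m, by rw [inner_neg_right, hm]; push_cast; ring⟩
  let v : (Fin 2 → ℤ) → Plane := fun n =>
    (InnerProductSpace.toDual ℝ Plane).symm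
      (LinearMap.toContinuousLinearMap (L.a.constr ℝ fun i => 2 * Real.pi * (n i : ℝ)))
  have hv : ∀ n i, ⟪v n, L.a i⟫_ℝ = 2 * Real.pi * n i := by
    intro n i
    simp only [v, InnerProductSpace.toDual_symm_apply, LinearMap.coe_toContinuousLinearMap',
      Module.Basis.constr_basis]
  have hpi : (2 * Real.pi : ℝ) ≠ 0 := by positivity
  refine ⟨Equiv.ofBijective (fun n => ⟨v n, hmem _ fun i => ⟨n i, hv n i⟩⟩) ⟨?_, ?_⟩,
    fun n i => hv n i⟩
  · intro n n' h
    have h' : v n = v n' := congrArg Subtype.val h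
    funext i
    have := hv n i
    rw [h', hv n' i] at this
    exact_mod_cast (mul_left_cancel₀ hpi this).symm
  · rintro ⟨G, hG⟩
    choose n hn using fun i => hG (L.a i) (AddSubgroup.subset_closure ⟨i, rfl⟩)
    refine ⟨n, Subtype.ext ?_⟩
    exact InnerProductSpace.ext_inner_right_basis L.a fun i => by rw [hv, hn]

theorem MoireLattice.exp_inner_eq_mFourier {s : Plane} {t : UnitAddTorus (Fin 2)}
    (hs : ∀ i, ((L.a.repr s i : ℝ) : UnitAddCircle) = t i) {G : Plane} {n : Fin 2 → ℤ}
    (hG : ∀ i, ⟪G, L.a i⟫_ℝ = 2 * Real.pi * n i) :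
    Complex.exp (-Complex.I * (⟪G, s⟫_ℝ : ℂ)) = UnitAddTorus.mFourier (-n) t := by
  have h : ⟪G, s⟫_ℝ = ∑ i, L.a.repr s i * (2 * Real.pi * n i) := by
    conv_lhs => rw [← L.a.sum_repr s]
    simp only [inner_sum, inner_smul_right, hG]
  simp only [UnitAddTorus.mFourier, ContinuousMap.coe_mk, ← hs, fourier_coe_apply, h,
    ← Complex.exp_sum]
  congr 1
  push_cast
  rw [Finset.mul_sum]
  refine Finset.sum_congr rfl fun i _ => ?_
  simp only [Pi.neg_apply, Int.cast_neg]
  ring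

/-- **Parseval's identity** for square-integrable functions on the unit cell of a lattice. -/
theorem MoireLattice.hasSum_fourier {f g : Plane → ℂ}
    (hf : MemLp f 2 (volume.restrict L.cell)) (hg : MemLp g 2 (volume.restrict L.cell)) :
    HasSum (fun G : L.dual =>
      starRingEnd ℂ (∫ r in L.cell, Complex.exp (-Complex.I * (⟪(G : Plane), r⟫_ℝ : ℂ)) * f r) *
        ∫ r in L.cell, Complex.exp (-Complex.I * (⟪(G : Plane), r⟫_ℝ : ℂ)) * g r)
      (L.area * ∫ r in L.cell, starRingEnd ℂ (f r) * g r) := by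
  obtain ⟨s, hs, hst⟩ := L.exists_measurePreserving_torus
  obtain ⟨e, he⟩ := L.exists_dual_equiv
  have hA : (L.area : ℂ) ≠ 0 := by exact_mod_cast L.area_pos.ne'
  have hinv : ((volume : Measure Plane) L.cell)⁻¹ ≠ ⊤ :=
    ENNReal.inv_ne_top.2 L.volume_cell_ne_zero
  have hint : ∀ h : Plane → ℂ, AEStronglyMeasurable h (volume.restrict L.cell) →
      ∫ r in L.cell, h r = L.area * ∫ t, h (s t) := by
    intro h hh
    rw [← integral_map hs.measurable.aemeasurable
      (by rw [hs.map_eq]; exact hh.mono_ac Measure.smul_absolutelyContinuous), hs.map_eq,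
      integral_smul_measure, ENNReal.toReal_inv, Complex.real_smul, ← mul_assoc]
    have : (L.area : ℂ) * ((((volume : Measure Plane) L.cell).toReal⁻¹ : ℝ) : ℂ) = 1 := by
      rw [Complex.ofReal_inv]; exact mul_inv_cancel₀ hA
    rw [this, one_mul]
  have hexp : ∀ G : Plane, Continuous fun r : Plane =>
      Complex.exp (-Complex.I * (⟪G, r⟫_ℝ : ℂ)) := fun G => by fun_prop
  have hF : ∀ h : Plane → ℂ, MemLp h 2 (volume.restrict L.cell) → MemLp (h ∘ s) 2 volume :=
    fun h hh => (hh.smul_measure hinv).comp_measurePreserving hs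
  have hco : ∀ (h : Plane → ℂ) (hh : MemLp h 2 (volume.restrict L.cell)) (n : Fin 2 → ℤ),
      ∫ r in L.cell, Complex.exp (-Complex.I * (⟪(e n : Plane), r⟫_ℝ : ℂ)) * h r =
        L.area * UnitAddTorus.mFourierCoeff ((hF h hh).toLp) n := by
    intro h hh n
    rw [hint (fun r => Complex.exp (-Complex.I * (⟪(e n : Plane), r⟫_ℝ : ℂ)) * h r)
      ((hexp _).aestronglyMeasurable.mul hh.1), UnitAddTorus.mFourierCoeff]
    congr 1
    refine integral_congr_ae ?_
    filter_upwards [(hF h hh).coeFn_toLp] with t ht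
    rw [ht, L.exp_inner_eq_mFourier (hst t) (he n)]
    rfl
  -- Each coefficient over the cell is the area times a torus coefficient, so the product carries
  -- the area squared; one factor is absorbed on passing back to the integral over the cell.
  have key := (UnitAddTorus.hasSum_prod_mFourierCoeff (hF f hf).toLp (hF g hg).toLp).mul_left
    ((L.area : ℂ) * L.area)
  rw [← e.hasSum_iff]
  convert! key using 1
  · funext n
    simp only [Function.comp_apply, hco f hf, hco g hg, map_mul, Complex.conj_ofReal]
    ring
  · rw [hint (fun r => starRingEnd ℂ (f r) * g r)
      ((Complex.continuous_conj.comp_aestronglyMeasurable hf.1).mul hg.1), mul_assoc]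
    congr 2
    refine integral_congr_ae ?_
    filter_upwards [(hF f hf).coeFn_toLp, (hF g hg).coeFn_toLp] with t h1 h2
    rw [h1, h2]; rfl

end Parseval

namespace FlatBands

variable {L : MoireLattice} {N M : ℕ} (S : FlatBands L N M)

/-- The form factors are the overlaps of the periodic Bloch functions. -/
theorem formFactor_apply (k q : Plane) (m n : Fin (2 * M)) :
    S.formFactor k q m n = ⟪S.uLp m k, S.uLp n (k + q)⟫_ℂ := by
  have hA : (L.area : ℂ) ≠ 0 := by exact_mod_cast L.area_pos.ne'
  have hexp : ∀ G : Plane, Continuous fun r : Plane =>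
      Complex.exp (-Complex.I * (⟪G, r⟫_ℝ : ℂ)) := fun G => by fun_prop
  have hu : ∀ n k c, MemLp (fun r => S.u n k r c) 2 (volume.restrict L.cell) :=
    fun n k c => (S.memLp n k).eval_piLp c
  have hhat : ∀ n k G c, S.uHat n k G c =
      ∫ r in L.cell, Complex.exp (-Complex.I * (⟪G, r⟫_ℝ : ℂ)) * S.u n k r c := by
    intro n k G c
    refine eval_integral_piLp (fun c => ?_) c
    refine Integrable.bdd_mul (c := 1) ((hu n k c).integrable one_le_two)
      (hexp G).aestronglyMeasurable (Filter.Eventually.of_forall fun r => ?_)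
    rw [show -Complex.I * (⟪G, r⟫_ℝ : ℂ) = ((-⟪G, r⟫_ℝ : ℝ) : ℂ) * Complex.I by push_cast; ring,
      Complex.norm_exp_ofReal_mul_I]
  have hsum : HasSum (fun G : L.dual => ⟪S.uHat m k G, S.uHat n (k + q) G⟫_ℂ)
      (∑ c, L.area * ∫ r in L.cell, starRingEnd ℂ (S.u m k r c) * S.u n (k + q) r c) := by
    have := hasSum_sum fun c (_ : c ∈ Finset.univ) =>
      L.hasSum_fourier (hu m k c) (hu n (k + q) c)
    refine this.congr_fun fun G => ?_
    rw [PiLp.inner_apply]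
    refine Finset.sum_congr rfl fun c _ => ?_
    rw [hhat, hhat, RCLike.inner_apply, mul_comm]
  rw [formFactor, Matrix.of_apply, hsum.tsum_eq, ← Finset.mul_sum, ← integral_finsetSum,
    L2.inner_def]
  · rw [← mul_assoc]
    push_cast
    rw [one_div, inv_mul_cancel₀ hA, one_mul]
    refine integral_congr_ae ?_
    filter_upwards [(S.memLp m k).coeFn_toLp, (S.memLp n (k + q)).coeFn_toLp] with r h1 h2
    rw [uLp, uLp, h1, h2, PiLp.inner_apply]
    refine Finset.sum_congr rfl fun c _ => ?_
    rw [RCLike.inner_apply, mul_comm]; rfl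
  · intro c _
    exact MemLp.integrable_mul (hu m k c).star (hu n (k + q) c)

end FlatBands

/-! ### Linear relations on the 1-RDM from annihilating one-body operators. -/

section Hopping

/-- The constants subtracted in `ρ̂` are central, so they disappear from the commutator. -/
theorem commutator_smul_sub {A : Type*} [Ring A] [Algebra ℂ A] (w z : ℂ) (a T : A) :
    w • (a - z • 1) * T - T * (w • (a - z • 1)) = w • (a * T - T * a) := by
  rw [smul_mul_assoc, mul_smul_comm, ← smul_sub, sub_mul, mul_sub, smul_mul_assoc, mul_smul_comm,
    one_mul, mul_one, sub_sub_sub_cancel_right]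

variable {ι : Type} [Fintype ι] [LinearOrder ι]

/-- If a one-body operator, up to a constant, and its adjoint annihilate a state, then its
coefficients intertwine the one-particle density matrix of the state. -/
theorem sum_hop_eq {J : Type*} [Fintype J] (w z : J → ℂ) (α β : J → ι) (X : Fock ι →L[ℂ] Fock ι)
    (hX : X = ∑ x, w x •
      (ContinuousLinearMap.adjoint (annihilate (α x)) * annihilate (β x) - z x • 1))
    {Ψ : Fock ι} (h : X Ψ = 0) (h' : ContinuousLinearMap.adjoint X Ψ = 0) (m n : ι) :
    ∑ x, w x * (if β x = m then
        ⟪Ψ, ContinuousLinearMap.adjoint (annihilate (α x)) (annihilate n Ψ)⟫_ℂ else 0) =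
      ∑ x, w x * (if n = α x then
        ⟪Ψ, ContinuousLinearMap.adjoint (annihilate m) (annihilate (β x) Ψ)⟫_ℂ else 0) := by
  set T := ContinuousLinearMap.adjoint (annihilate m) * annihilate n with hT
  have h0 : ⟪Ψ, (X * T - T * X) Ψ⟫_ℂ = 0 := by
    rw [sub_apply, mul_apply_eq_comp X T, mul_apply_eq_comp T X, h, map_zero, sub_zero,
      ← ContinuousLinearMap.adjoint_inner_left, h', inner_zero_left]
  have h1 : X * T - T * X = ∑ x, w x •
      ((if β x = m then (1 : ℂ) else 0) •
          (ContinuousLinearMap.adjoint (annihilate (α x)) * annihilate n) -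
        (if n = α x then (1 : ℂ) else 0) •
          (ContinuousLinearMap.adjoint (annihilate m) * annihilate (β x))) := by
    rw [hX, Finset.sum_mul, Finset.mul_sum, ← Finset.sum_sub_distrib]
    refine Finset.sum_congr rfl fun x _ => ?_
    rw [← commutator_hop, ← hT, commutator_smul_sub]
  rw [h1, sum_apply, inner_sum] at h0
  rw [← sub_eq_zero, ← Finset.sum_sub_distrib]
  refine Eq.trans ?_ h0
  refine Finset.sum_congr rfl fun x _ => ?_
  rw [smul_apply, sub_apply, inner_smul_right, inner_sub_right, smul_apply, smul_apply,
    inner_smul_right, inner_smul_right, mul_sub]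
  simp only [ite_mul, one_mul, zero_mul, mul_apply_eq_comp]

end Hopping

/-! ### The group of momenta and its action on the grid. -/

namespace MoireLattice

variable (L : MoireLattice) {nx ny : ℕ}

theorem mem_dual_iff {G : Plane} :
    G ∈ L.dual ↔ ∃ a b : ℤ, G = (a : ℝ) • L.g 0 + (b : ℝ) • L.g 1 := by
  have : L.dual = AddSubgroup.closure (Set.range L.g) := L.closure_g.symm
  rw [this]
  constructor
  · intro h
    induction h using AddSubgroup.closure_induction with
    | mem x hx =>
      obtain ⟨i, rfl⟩ := hx
      fin_cases i
      · exact ⟨1, 0, by simp⟩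
      · exact ⟨0, 1, by simp⟩
    | zero => exact ⟨0, 0, by simp⟩
    | add x y _ _ hx hy =>
      obtain ⟨a, b, rfl⟩ := hx
      obtain ⟨a', b', rfl⟩ := hy
      exact ⟨a + a', b + b', by push_cast; module⟩
    | neg x _ hx =>
      obtain ⟨a, b, rfl⟩ := hx
      exact ⟨-a, -b, by push_cast; module⟩
  · rintro ⟨a, b, rfl⟩
    simp only [Int.cast_smul_eq_zsmul]
    exact add_mem (zsmul_mem (AddSubgroup.subset_closure (Set.mem_range_self 0)) a)
      (zsmul_mem (AddSubgroup.subset_closure (Set.mem_range_self 1)) b)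

theorem coeff_ext {a b a' b' : ℝ} (h : a • L.g 0 + b • L.g 1 = a' • L.g 0 + b' • L.g 1) :
    a = a' ∧ b = b' := by
  have := congrArg L.g.repr h
  constructor
  · simpa using DFunLike.congr_fun this 0
  · simpa using DFunLike.congr_fun this 1

/-- Distinct grid points are inequivalent modulo the reciprocal lattice. -/
theorem gridPoint_inj_mod {κ κ' : Fin nx × Fin ny}
    (h : L.gridPoint κ - L.gridPoint κ' ∈ L.dual) : κ = κ' := by
  obtain ⟨a, b, hab⟩ := L.mem_dual_iff.1 h
  have key : ∀ (n : ℕ) (i i' : Fin n) (c : ℤ), (i : ℝ) / n - (i' : ℝ) / n = c → i = i' := by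
    intro n i i' c hc
    have hn : (n : ℝ) ≠ 0 := by exact_mod_cast (Fin.pos i).ne'
    have h1 : (i : ℝ) - i' = c * n := by field_simp at hc; linarith
    have h2 : (i : ℤ) - i' = c * n := by exact_mod_cast h1
    have hi := i.2
    have hi' := i'.2
    have hc0 : c = 0 := by
      by_contra hne
      rcases lt_or_gt_of_ne hne with hlt | hgt
      · have : c * n ≤ (-1) * n := mul_le_mul_of_nonneg_right (by omega) (by omega)
        omega
      · have : 1 * (n : ℤ) ≤ c * n := mul_le_mul_of_nonneg_right (by omega) (by omega)
        omega
    rw [hc0] at h2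
    exact Fin.ext (by omega)
  have hd : L.gridPoint κ - L.gridPoint κ' =
      ((κ.1 : ℝ) / nx - (κ'.1 : ℝ) / nx) • L.g 0 + ((κ.2 : ℝ) / ny - (κ'.2 : ℝ) / ny) • L.g 1 := by
    simp only [gridPoint]; module
  obtain ⟨h1, h2⟩ := L.coeff_ext (hd.symm.trans hab)
  exact Prod.ext (key _ _ _ _ h1) (key _ _ _ _ h2)

theorem mem_momenta_iff {q : Plane} :
    q ∈ L.momenta nx ny ↔ ∃ κ : Fin nx × Fin ny, q - L.gridPoint κ ∈ L.dual := by
  constructor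
  · rintro ⟨_, ⟨κ, rfl⟩, G, hG, rfl⟩
    exact ⟨κ, by simpa using hG⟩
  · rintro ⟨κ, h⟩
    exact ⟨_, ⟨κ, rfl⟩, _, h, by simp⟩

/-- Division with remainder splits integer coordinates into a reciprocal vector and a grid point. In
this form, closure under addition and negation is evident. -/
theorem mem_momenta_iff_int (hx : 0 < nx) (hy : 0 < ny) {q : Plane} :
    q ∈ L.momenta nx ny ↔
      ∃ i j : ℤ, q = ((i : ℝ) / nx) • L.g 0 + ((j : ℝ) / ny) • L.g 1 := by
  have hx' : (nx : ℝ) ≠ 0 := by exact_mod_cast hx.ne'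
  have hy' : (ny : ℝ) ≠ 0 := by exact_mod_cast hy.ne'
  rw [mem_momenta_iff]
  constructor
  · rintro ⟨κ, h⟩
    obtain ⟨a, b, hab⟩ := L.mem_dual_iff.1 h
    refine ⟨a * nx + (κ.1 : ℕ), b * ny + (κ.2 : ℕ), ?_⟩
    rw [sub_eq_iff_eq_add.1 hab, gridPoint]
    push_cast
    rw [add_div, add_div, mul_div_cancel_right₀ _ hx', mul_div_cancel_right₀ _ hy']
    module
  · rintro ⟨i, j, rfl⟩
    have hi := Int.emod_nonneg i (b := nx) (by omega)
    have hi' := Int.emod_lt_of_pos i (b := nx) (by omega)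
    have hj := Int.emod_nonneg j (b := ny) (by omega)
    have hj' := Int.emod_lt_of_pos j (b := ny) (by omega)
    have ei : (i : ℝ) = nx * (i / (nx : ℤ) : ℤ) + ((i % nx).toNat : ℕ) := by
      have h1 : ((i % nx).toNat : ℤ) = i % nx := Int.toNat_of_nonneg hi
      have h2 : (nx : ℤ) * (i / nx) + ((i % nx).toNat : ℤ) = i := by
        rw [h1]; exact Int.mul_ediv_add_emod i nx
      exact_mod_cast h2.symm
    have ej : (j : ℝ) = ny * (j / (ny : ℤ) : ℤ) + ((j % ny).toNat : ℕ) := by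
      have h1 : ((j % ny).toNat : ℤ) = j % ny := Int.toNat_of_nonneg hj
      have h2 : (ny : ℤ) * (j / ny) + ((j % ny).toNat : ℤ) = j := by
        rw [h1]; exact Int.mul_ediv_add_emod j ny
      exact_mod_cast h2.symm
    refine ⟨(⟨(i % nx).toNat, by omega⟩, ⟨(j % ny).toNat, by omega⟩), L.mem_dual_iff.2
      ⟨i / nx, j / ny, ?_⟩⟩
    rw [gridPoint, ei, ej, add_div, add_div, mul_div_cancel_left₀ _ hx',
      mul_div_cancel_left₀ _ hy']
    simp only []
    module

/-- The momenta `𝒦 + Γ*` as a subgroup of the plane. -/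
def momentaSubgroup (hx : 0 < nx) (hy : 0 < ny) : AddSubgroup Plane where
  carrier := L.momenta nx ny
  zero_mem' := (L.mem_momenta_iff_int hx hy).2 ⟨0, 0, by simp⟩
  add_mem' := by
    intro p q hp hq
    obtain ⟨i, j, rfl⟩ := (L.mem_momenta_iff_int hx hy).1 hp
    obtain ⟨i', j', rfl⟩ := (L.mem_momenta_iff_int hx hy).1 hq
    refine (L.mem_momenta_iff_int hx hy).2 ⟨i + i', j + j', ?_⟩
    push_cast
    rw [add_div, add_div]
    module
  neg_mem' := by
    intro p hp
    obtain ⟨i, j, rfl⟩ := (L.mem_momenta_iff_int hx hy).1 hp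
    refine (L.mem_momenta_iff_int hx hy).2 ⟨-i, -j, ?_⟩
    push_cast
    rw [neg_div, neg_div]
    module

theorem grid_subset_momenta : L.grid nx ny ⊆ L.momenta nx ny :=
  fun k hk => ⟨k, hk, 0, zero_mem _, by simp⟩

theorem gridPoint_mem_momenta (κ : Fin nx × Fin ny) : L.gridPoint κ ∈ L.momenta nx ny :=
  L.grid_subset_momenta ⟨κ, rfl⟩

/-- Translation by a momentum permutes the grid points modulo the reciprocal lattice. -/
theorem exists_perm_gridPoint {q : Plane} (hq : q ∈ L.momenta nx ny) :
    ∃ σ : Equiv.Perm (Fin nx × Fin ny),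
      ∀ κ, L.gridPoint κ + q - L.gridPoint (σ κ) ∈ L.dual := by
  have hpos : 0 < nx ∧ 0 < ny := by
    obtain ⟨κ, -⟩ := L.mem_momenta_iff.1 hq
    exact ⟨Fin.pos κ.1, Fin.pos κ.2⟩
  choose σ hσ using fun κ : Fin nx × Fin ny => L.mem_momenta_iff.1
    ((L.momentaSubgroup hpos.1 hpos.2).add_mem (L.gridPoint_mem_momenta κ) hq)
  have hinj : Function.Injective σ := by
    intro κ κ' h
    apply L.gridPoint_inj_mod
    have h1 := sub_mem (hσ κ) (hσ κ')
    rw [h] at h1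
    convert h1 using 1
    abel
  exact ⟨Equiv.ofBijective σ (Finite.injective_iff_bijective.1 hinj), hσ⟩

end MoireLattice

/-! ### Symmetries of the form factors. -/

namespace FlatBands

variable {L : MoireLattice} {N M : ℕ} (S : FlatBands L N M)

theorem formFactor_conj (k q : Plane) (m n : Fin (2 * M)) :
    starRingEnd ℂ (S.formFactor k q m n) = S.formFactor (k + q) (-q) n m := by
  rw [formFactor_apply, formFactor_apply, inner_conj_symm, add_neg_cancel_right]

/-- The phases of the two periodic parts combine to `exp(-i q · r)`, free of `k`; the remaining
dependence on `k` is through `ψ`, which is periodic in momentum. -/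
theorem formFactor_add_dual (k q : Plane) {G : Plane} (hG : G ∈ L.dual) :
    S.formFactor (k + G) q = S.formFactor k q := by
  have key : ∀ k m n, S.formFactor k q m n = ∫ r in L.cell,
      Complex.exp (-Complex.I * (⟪q, r⟫_ℝ : ℂ)) * ⟪S.ψ m k r, S.ψ n (k + q) r⟫_ℂ := by
    intro k m n
    rw [formFactor_apply, L2.inner_def]
    refine integral_congr_ae ?_
    filter_upwards [(S.memLp m k).coeFn_toLp, (S.memLp n (k + q)).coeFn_toLp] with r h1 h2
    rw [uLp, uLp, h1, h2, blochPart, blochPart, inner_smul_left, inner_smul_right, ← mul_assoc,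
      ← Complex.exp_conj, ← Complex.exp_add, inner_add_left]
    congr 2
    simp only [map_mul, map_neg, Complex.conj_I, Complex.conj_ofReal]
    push_cast
    ring
  ext m n
  rw [key, key, add_right_comm, S.ψ_add_dual _ _ _ hG, S.ψ_add_dual _ _ _ hG]

theorem formFactor_eq_of_sub_mem {k k' : Plane} (h : k - k' ∈ L.dual) (q : Plane) :
    S.formFactor k q = S.formFactor k' q := by
  rw [← S.formFactor_add_dual k' q h, add_sub_cancel]

end FlatBands

/-! ### Band operators, the adjoint of `ρ̂`, and the basic relation on the 1-RDM. -/

section Band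

variable (L : MoireLattice) {N M : ℕ} (nx ny : ℕ)

/-- The chosen grid index depends only on the predicate it satisfies, and equivalent momenta define
the same predicate. -/
theorem bandAnn_eq_of_sub_mem (n : Fin (2 * M)) {k k' : Plane} (h : k - k' ∈ L.dual) :
    bandAnn L nx ny n k = bandAnn L nx ny n k' := by
  classical
  have : (fun κ : Fin nx × Fin ny => k - L.gridPoint κ ∈ L.dual) =
      fun κ => k' - L.gridPoint κ ∈ L.dual := by
    funext κ
    rw [← sub_add_sub_cancel k k' (L.gridPoint κ)]
    exact propext (L.dual.add_mem_cancel_left h)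
  have key : ∀ P Q : Fin nx × Fin ny → Prop, P = Q →
      (if h : ∃ κ, P κ then annihilate (toLex (n, toLex h.choose)) else 0 :
        Fock (Mode M nx ny) →L[ℂ] Fock (Mode M nx ny)) =
      if h : ∃ κ, Q κ then annihilate (toLex (n, toLex h.choose)) else 0 := by
    rintro P _ rfl
    rfl
  exact key _ _ this

theorem bandAnn_gridPoint (n : Fin (2 * M)) (κ : Fin nx × Fin ny) :
    bandAnn L nx ny n (L.gridPoint κ) = annihilate (toLex (n, toLex κ)) := by
  have h : ∃ κ' : Fin nx × Fin ny, L.gridPoint κ - L.gridPoint κ' ∈ L.dual := ⟨κ, by simp⟩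
  rw [bandAnn, dif_pos h, ← L.gridPoint_inj_mod h.choose_spec]

variable {nx ny}

theorem bandAnn_eq_annihilate (n : Fin (2 * M)) {k : Plane} {κ : Fin nx × Fin ny}
    (h : k - L.gridPoint κ ∈ L.dual) :
    bandAnn L nx ny n k = annihilate (toLex (n, toLex κ)) := by
  rw [bandAnn_eq_of_sub_mem L nx ny n h, bandAnn_gridPoint]

theorem rdm_eq_of_sub_mem (Ψ : Fock (Mode M nx ny)) {k₁ k₂ k₁' k₂' : Plane}
    (h₁ : k₁ - k₁' ∈ L.dual) (h₂ : k₂ - k₂' ∈ L.dual) :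
    rdm L nx ny Ψ k₁ k₂ = rdm L nx ny Ψ k₁' k₂' := by
  ext n m
  simp only [rdm, Matrix.of_apply, bandCre, bandAnn_eq_of_sub_mem L nx ny _ h₁,
    bandAnn_eq_of_sub_mem L nx ny _ h₂]

variable {L} (S : FlatBands L N M)

/-- Taking adjoints turns a hop from `k + q` to `k` into one from `k` to `k + q`. Reindexing the sum
by the permutation `k ↦ k + q` modulo `Γ*` matches the terms, and `formFactor_conj` matches the
coefficients. -/
theorem adjoint_rhoHat {q : Plane} (hq : q ∈ L.momenta nx ny) :
    ContinuousLinearMap.adjoint (rhoHat nx ny S q) = rhoHat nx ny S (-q) := by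
  obtain ⟨σ, hσ⟩ := L.exists_perm_gridPoint hq
  have hmem : ∀ κ, L.gridPoint (σ κ) + -q - L.gridPoint κ ∈ L.dual := fun κ => by
    have := neg_mem (hσ κ)
    convert this using 1
    abel
  unfold rhoHat
  conv_rhs => rw [← Equiv.sum_comp σ]
  rw [map_sum]
  refine Finset.sum_congr rfl fun κ _ => ?_
  rw [map_sum, Finset.sum_comm]
  simp only [map_sum]
  refine Finset.sum_congr rfl fun n _ => Finset.sum_congr rfl fun m _ => ?_
  rw [← S.formFactor_eq_of_sub_mem (hσ κ), ← S.formFactor_conj]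
  simp only [bandCre, ← bandAnn_eq_of_sub_mem L nx ny _ (hσ κ),
    bandAnn_eq_of_sub_mem L nx ny _ (hmem κ), ← ContinuousLinearMap.star_eq_adjoint, star_smul,
    star_sub, star_mul, star_star, star_one]
  have hiff : (n = m ∧ q ∈ L.dual) ↔ (m = n ∧ -q ∈ L.dual) := by
    rw [neg_mem_iff, eq_comm]
  congr 3
  by_cases h : m = n ∧ -q ∈ L.dual
  · rw [if_pos h, if_pos (hiff.2 h)]
    simp
  · rw [if_neg h, if_neg (mt hiff.1 h)]
    simp

/-- The form factors intertwine the blocks of the 1-RDM of a state annihilated by all `ρ̂(q)`. -/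
theorem formFactor_mul_rdm {Ψ : Fock (Mode M nx ny)} {q : Plane} (hq : q ∈ L.momenta nx ny)
    (hΨ : rhoHat nx ny S q Ψ = 0) (hΨ' : rhoHat nx ny S (-q) Ψ = 0) {k₁ k₂ : Plane}
    (hk₁ : k₁ ∈ L.momenta nx ny) (hk₂ : k₂ ∈ L.momenta nx ny) :
    S.formFactor k₁ q * rdm L nx ny Ψ (k₁ + q) (k₂ + q) =
      rdm L nx ny Ψ k₁ k₂ * S.formFactor k₂ q := by
  classical
  obtain ⟨σ, hσ⟩ := L.exists_perm_gridPoint hq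
  obtain ⟨κ₁, h₁⟩ := L.mem_momenta_iff.1 hk₁
  obtain ⟨κ₂, h₂⟩ := L.mem_momenta_iff.1 hk₂
  have hs : ∀ {k : Plane} {κ : Fin nx × Fin ny}, k - L.gridPoint κ ∈ L.dual →
      k + q - L.gridPoint (σ κ) ∈ L.dual := fun {k κ} h => by
    convert add_mem h (hσ κ) using 1
    abel
  have hX : rhoHat nx ny S q = ∑ x : (Fin nx × Fin ny) × Fin (2 * M) × Fin (2 * M),
      S.formFactor (L.gridPoint x.1) q x.2.1 x.2.2 •
        (ContinuousLinearMap.adjoint (annihilate (toLex (x.2.1, toLex x.1))) *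
          annihilate (toLex (x.2.2, toLex (σ x.1))) -
          (if x.2.1 = x.2.2 ∧ q ∈ L.dual then (1 / 2 : ℂ) else 0) • 1) := by
    simp only [rhoHat, Fintype.sum_prod_type, bandCre, bandAnn_gridPoint,
      bandAnn_eq_annihilate L _ (hσ _)]
  have sum3 : ∀ f : (Fin nx × Fin ny) × Fin (2 * M) × Fin (2 * M) → ℂ,
      ∑ x, f x = ∑ κ, ∑ a, ∑ b, f (κ, a, b) := fun f => by
    rw [Fintype.sum_prod_type]
    exact Finset.sum_congr rfl fun κ _ => Fintype.sum_prod_type _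
  ext n m
  -- The test hop goes from `k₁` to `k₂ + q`. The Kronecker deltas then leave `κ₂` in one sum and
  -- `κ₁` in the other, so each becomes a matrix product.
  have key := sum_hop_eq _ _ _ _ _ hX hΨ (by rw [adjoint_rhoHat S hq, hΨ'])
    (toLex (m, toLex (σ κ₂))) (toLex (n, toLex κ₁))
  rw [sum3, sum3] at key
  simp only [EmbeddingLike.apply_eq_iff_eq, Prod.mk.injEq] at key
  rw [S.formFactor_eq_of_sub_mem h₁, S.formFactor_eq_of_sub_mem h₂]
  simp only [Matrix.mul_apply, rdm, Matrix.of_apply, bandCre, bandAnn_eq_annihilate L _ h₁,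
    bandAnn_eq_annihilate L _ h₂, bandAnn_eq_annihilate L _ (hs h₁),
    bandAnn_eq_annihilate L _ (hs h₂)]
  refine Eq.trans ?_ (key.symm.trans ?_)
  · symm
    rw [Finset.sum_eq_single κ₁ (fun κ _ hκ => by simp [hκ.symm]) (by simp),
      Finset.sum_eq_single n (fun a _ ha => by simp [ha.symm]) (by simp)]
    simp
  · rw [Finset.sum_eq_single κ₂ (fun κ _ hκ => by simp [hκ]) (by simp)]
    refine Finset.sum_congr rfl fun a _ => ?_
    rw [Finset.sum_eq_single m (fun b _ hb => by simp [hb]) (by simp)]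
    simp [mul_comm]

end Band

/-! ### Invertibility of form factors between close projectors. -/

namespace FlatBands

variable {L : MoireLattice} {N M : ℕ} (S : FlatBands L N M)

theorem inner_uLp (m n : Fin (2 * M)) (k : Plane) :
    ⟪S.uLp m k, S.uLp n k⟫_ℂ = if m = n then 1 else 0 := by
  rw [← S.orthonormal m n k, L2.inner_def]
  refine integral_congr_ae ?_
  filter_upwards [(S.memLp m k).coeFn_toLp, (S.memLp n k).coeFn_toLp] with r h1 h2
  rw [uLp, uLp, h1, h2]

/-- The form factor between two momenta is invertible if the band projectors there are at distance
less than one. -/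
theorem isUnit_formFactor {k q : Plane} (h : ‖S.proj (k + q) - S.proj k‖ < 1) :
    IsUnit (S.formFactor k q) := by
  rw [Matrix.isUnit_iff_isUnit_det, isUnit_iff_ne_zero]
  intro hdet
  obtain ⟨v, hv, hΛ⟩ := Matrix.exists_mulVec_eq_zero_iff.2 hdet
  -- A kernel vector yields a nonzero `f` in the range of `Π(k + q)` and orthogonal to that of
  -- `Π(k)`. The difference of the projectors fixes `f`, so its norm is at least one.
  set f := ∑ n, v n • S.uLp n (k + q) with hf
  have hf0 : f ≠ 0 := by
    intro h0
    apply hv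
    funext m
    have : ⟪S.uLp m (k + q), f⟫_ℂ = v m := by
      simp [hf, inner_sum, inner_smul_right, inner_uLp]
    rw [← this, h0, inner_zero_right, Pi.zero_apply]
  have h1 : S.proj (k + q) f = f := by
    have : FiniteDimensional ℂ (Submodule.span ℂ (Set.range fun n => S.uLp n (k + q))) :=
      FiniteDimensional.span_of_finite ℂ (Set.finite_range _)
    exact Submodule.starProjection_eq_self_iff.2 (Submodule.sum_mem _ fun n _ =>
      Submodule.smul_mem _ _ (Submodule.subset_span ⟨n, rfl⟩))
  have h2 : S.proj k f = 0 := by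
    have : FiniteDimensional ℂ (Submodule.span ℂ (Set.range fun n => S.uLp n k)) :=
      FiniteDimensional.span_of_finite ℂ (Set.finite_range _)
    refine (Submodule.starProjection_apply_eq_zero_iff _).2 ?_
    rw [Submodule.mem_orthogonal]
    intro u hu
    induction hu using Submodule.span_induction with
    | mem x hx =>
      obtain ⟨m, rfl⟩ := hx
      have := congrFun hΛ m
      simpa [hf, inner_sum, inner_smul_right, Matrix.mulVec, dotProduct, formFactor_apply,
        mul_comm] using this
    | zero => exact inner_zero_left _
    | add x y _ _ hx hy => rw [inner_add_left, hx, hy, add_zero]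
    | smul c x _ hx => rw [inner_smul_left, hx, mul_zero]
  have h3 := (S.proj (k + q) - S.proj k).le_opNorm f
  rw [sub_apply, h1, h2, sub_zero] at h3
  have : 0 < ‖f‖ := norm_pos_iff.2 hf0
  nlinarith

end FlatBands

/-! ### Ground states -/

section GroundState

variable {L : MoireLattice} {N M nx ny : ℕ} (S : FlatBands L N M) (Vhat : Plane → ℝ)

/-- The left factor `ρ̂(q)` is the adjoint of `ρ̂(-q)`, which makes the term a positive multiple of
`R* R` once `V̂(q) > 0`. -/
theorem inner_fbiTerm {q : Plane} (hq' : -q ∈ L.momenta nx ny)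
    (Φ : Fock (Mode M nx ny)) :
    ⟪Φ, fbiTerm nx ny S Vhat q Φ⟫_ℂ = ((Vhat q * ‖rhoHat nx ny S (-q) Φ‖ ^ 2 : ℝ) : ℂ) := by
  have h : rhoHat nx ny S q = ContinuousLinearMap.adjoint (rhoHat nx ny S (-q)) := by
    rw [adjoint_rhoHat S hq', neg_neg]
  rw [fbiTerm, smul_apply, inner_smul_right, mul_apply_eq_comp, h,
    ContinuousLinearMap.adjoint_inner_right, inner_self_eq_norm_sq_to_K]
  push_cast
  rfl

/-- Every ground state of a frustration-free FBI Hamiltonian is annihilated by all `ρ̂(q)`. -/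
theorem rhoHat_apply_eq_zero (hx : 0 < nx) (hy : 0 < ny) (hV : ∀ q, 0 < Vhat q)
    (hH : Summable fun q : L.momenta nx ny => fbiTerm nx ny S Vhat q)
    (hff : IsFrustrationFree nx ny S Vhat) {Ψ : Fock (Mode M nx ny)}
    (hΨ : IsGroundState (fbiHamiltonian nx ny S Vhat) Ψ) {q : Plane}
    (hq : q ∈ L.momenta nx ny) : rhoHat nx ny S q Ψ = 0 := by
  have hneg : ∀ {q : Plane}, q ∈ L.momenta nx ny → -q ∈ L.momenta nx ny := fun h =>
    (L.momentaSubgroup hx hy).neg_mem h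
  have hsum : ∀ Φ : Fock (Mode M nx ny), HasSum
      (fun q : L.momenta nx ny => Vhat q * ‖rhoHat nx ny S (-q) Φ‖ ^ 2)
      (⟪Φ, (∑' q : L.momenta nx ny, fbiTerm nx ny S Vhat q) Φ⟫_ℂ).re := by
    intro Φ
    have h1 := (innerSL ℂ Φ).hasSum
      ((ContinuousLinearMap.apply ℂ (Fock (Mode M nx ny)) Φ).hasSum hH.hasSum)
    refine (Complex.hasSum_re h1).congr_fun fun q => ?_
    simp only [ContinuousLinearMap.apply_apply, innerSL_apply_apply,
      inner_fbiTerm S Vhat (hneg q.2), Complex.ofReal_re]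
  have hc : 0 < 1 / (((nx * ny : ℕ) : ℝ) * L.area) := by
    have := L.area_pos
    have : 0 < ((nx * ny : ℕ) : ℝ) := by exact_mod_cast Nat.mul_pos hx hy
    positivity
  have hE : ∀ Φ : Fock (Mode M nx ny), (⟪Φ, fbiHamiltonian nx ny S Vhat Φ⟫_ℂ).re =
      1 / (((nx * ny : ℕ) : ℝ) * L.area) *
        (⟪Φ, (∑' q : L.momenta nx ny, fbiTerm nx ny S Vhat q) Φ⟫_ℂ).re := fun Φ => by
    rw [fbiHamiltonian, smul_apply, inner_smul_right, Complex.re_ofReal_mul]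
  have hnn : ∀ (Φ : Fock (Mode M nx ny)) (q : L.momenta nx ny),
      0 ≤ Vhat q * ‖rhoHat nx ny S (-q) Φ‖ ^ 2 := fun Φ q =>
    mul_nonneg (hV q).le (sq_nonneg _)
  obtain ⟨Φ, hΦ, hΦ0⟩ := hff
  have h0 : (⟪Φ, (∑' q : L.momenta nx ny, fbiTerm nx ny S Vhat q) Φ⟫_ℂ).re = 0 := by
    refine (hsum Φ).unique ((hasSum_zero).congr_fun fun q => ?_)
    have := hΦ0 q q.2
    rw [inner_fbiTerm S Vhat (hneg q.2)] at this
    exact_mod_cast this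
  have hle := hΨ.2 Φ hΦ.1
  rw [hE, hE, h0, mul_zero] at hle
  have hΨ0 : (⟪Ψ, (∑' q : L.momenta nx ny, fbiTerm nx ny S Vhat q) Ψ⟫_ℂ).re = 0 :=
    le_antisymm (nonpos_of_mul_nonpos_right hle hc) ((hsum Ψ).nonneg (hnn Ψ))
  have hs := hsum Ψ
  rw [hΨ0, hasSum_zero_iff_of_nonneg (hnn Ψ)] at hs
  -- The term with index `-q` is the one that contains `ρ̂(q)`.
  have := congrFun hs ⟨-q, hneg hq⟩
  simpa [(hV (-q)).ne'] using this

end GroundState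

/-! ### Intertwiners of the blocks of the 1-RDM -/

section Intertwiner

variable {L : MoireLattice} {N M : ℕ} (nx ny : ℕ) (S : FlatBands L N M)

/-- The families of matrices that intertwine the blocks at `(k₁, k₂)` and `(k₁ + q, k₂ + q)` of the
1-RDM of all states annihilated by the operators `ρ̂`. -/
def intertwiners (q : Plane) : Submodule ℂ (Plane → Matrix (Fin (2 * M)) (Fin (2 * M)) ℂ) where
  carrier := {X | ∀ Ψ : Fock (Mode M nx ny), (∀ p ∈ L.momenta nx ny, rhoHat nx ny S p Ψ = 0) →
    ∀ k₁ ∈ L.momenta nx ny, ∀ k₂ ∈ L.momenta nx ny,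
      X k₁ * rdm L nx ny Ψ (k₁ + q) (k₂ + q) = rdm L nx ny Ψ k₁ k₂ * X k₂}
  zero_mem' := fun Ψ _ k₁ _ k₂ _ => by simp
  add_mem' := fun hX hY Ψ hΨ k₁ h₁ k₂ h₂ => by
    rw [Pi.add_apply, Pi.add_apply, add_mul, mul_add, hX Ψ hΨ k₁ h₁ k₂ h₂, hY Ψ hΨ k₁ h₁ k₂ h₂]
  smul_mem' := fun c X hX Ψ hΨ k₁ h₁ k₂ h₂ => by
    rw [Pi.smul_apply, Pi.smul_apply, smul_mul_assoc, mul_smul_comm, hX Ψ hΨ k₁ h₁ k₂ h₂]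

variable {nx ny}

theorem formFactor_mem_intertwiners (hx : 0 < nx) (hy : 0 < ny) {q : Plane}
    (hq : q ∈ L.momenta nx ny) : (fun k => S.formFactor k q) ∈ intertwiners nx ny S q :=
  fun _ hΨ _ h₁ _ h₂ => formFactor_mul_rdm S hq (hΨ q hq)
    (hΨ (-q) ((L.momentaSubgroup hx hy).neg_mem hq)) h₁ h₂

/-- Successive shifts compose, with the second family evaluated at the shifted momentum. This is why
the relation is imposed on all of `𝒦 + Γ*` and not only on the grid. -/
theorem mul_mem_intertwiners (hx : 0 < nx) (hy : 0 < ny) {q q' : Plane}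
    (hq : q ∈ L.momenta nx ny) {X Y : Plane → Matrix (Fin (2 * M)) (Fin (2 * M)) ℂ}
    (hX : X ∈ intertwiners nx ny S q) (hY : Y ∈ intertwiners nx ny S q') :
    (fun k => X k * Y (k + q)) ∈ intertwiners nx ny S (q + q') := by
  intro Ψ hΨ k₁ h₁ k₂ h₂
  have hadd := fun k hk => (L.momentaSubgroup hx hy).add_mem (x := k) hk hq
  have e₁ := hX Ψ hΨ k₁ h₁ k₂ h₂
  have e₂ := hY Ψ hΨ _ (hadd k₁ h₁) _ (hadd k₂ h₂)
  rw [← add_assoc, ← add_assoc, mul_assoc, e₂, ← mul_assoc, e₁, mul_assoc]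

/-- The shift enters the relation only through the 1-RDM, which is `Γ*`-periodic; no periodicity of
`Λ_k(q)` in `q` is needed. It allows a path to end at the grid representative of `k + q`. -/
theorem intertwiners_le_of_sub_mem {q q' : Plane} (h : q - q' ∈ L.dual) :
    intertwiners nx ny S q ≤ intertwiners nx ny S q' := by
  intro X hX Ψ hΨ k₁ h₁ k₂ h₂
  rw [← hX Ψ hΨ k₁ h₁ k₂ h₂, rdm_eq_of_sub_mem L Ψ (k₁ := k₁ + q) (k₁' := k₁ + q')
    (k₂ := k₂ + q) (k₂' := k₂ + q') (by simpa using h) (by simpa using h)]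

/-- On a connected grid there is, for each shift and each grid point, an intertwiner that is
invertible at that grid point. -/
theorem exists_intertwiner_isUnit (hx : 0 < nx) (hy : 0 < ny) (hgrid : S.GridConnected nx ny)
    {q : Plane} (hq : q ∈ L.momenta nx ny) {k : Plane} (hk : k ∈ L.grid nx ny) :
    ∃ X ∈ intertwiners nx ny S q, IsUnit (X k) := by
  obtain ⟨k', hk', G, hG, hkq⟩ :=
    (L.momentaSubgroup hx hy).add_mem (L.grid_subset_momenta hk) hq
  obtain ⟨l, p, hp0, hpl, hp, hstep⟩ := hgrid k hk k' hk'
  have hdiff : ∀ {a b : Plane}, a ∈ L.grid nx ny → b ∈ L.grid nx ny → a - b ∈ L.momenta nx ny :=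
    fun ha hb => (L.momentaSubgroup hx hy).sub_mem (L.grid_subset_momenta ha)
      (L.grid_subset_momenta hb)
  have key : ∀ i ≤ l, ∃ X ∈ intertwiners nx ny S (p i - k), IsUnit (X k) := by
    intro i
    induction i with
    | zero =>
      intro _
      refine ⟨fun _ => 1, fun Ψ _ k₁ _ k₂ _ => ?_, isUnit_one⟩
      simp [hp0]
    | succ i ih =>
      intro hi
      obtain ⟨X, hX, hXk⟩ := ih (by omega)
      have hpi := hp i (by omega)
      -- At `a = k` the new factor is the form factor from `p i` to `p (i + 1)`, where the
      -- projectors are close. At other `a` nothing is claimed about its invertibility.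
      refine ⟨fun a => X a * S.formFactor (a + (p i - k)) (p (i + 1) - p i), ?_, hXk.mul ?_⟩
      · have := mul_mem_intertwiners S hx hy (hdiff hpi hk) hX
          (formFactor_mem_intertwiners S hx hy (hdiff (hp (i + 1) hi) hpi))
        rwa [show p i - k + (p (i + 1) - p i) = p (i + 1) - k by abel] at this
      · rw [add_sub_cancel]
        refine S.isUnit_formFactor ?_
        rw [add_sub_cancel]
        exact hstep i (by omega)
  obtain ⟨X, hX, hXk⟩ := key l le_rfl
  refine ⟨X, intertwiners_le_of_sub_mem S ?_ hX, hXk⟩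
  have : p l - k - q = -G := by
    rw [hpl, sub_sub, hkq]; abel
  rw [this]
  exact neg_mem hG

end Intertwiner

/-! ### Simultaneous invertibility by a generic linear combination. -/

/-- If a linear space of families of matrices contains for each index of a finite set a family that
is invertible at that index, then it contains one that is invertible at all of them. -/
theorem exists_mem_forall_isUnit {κ n 𝕜 : Type*} [Fintype n] [DecidableEq n] [Field 𝕜] [Infinite 𝕜]
    (W : Submodule 𝕜 (κ → Matrix n n 𝕜)) {s : Set κ} (hs : s.Finite)
    (h : ∀ k ∈ s, ∃ X ∈ W, IsUnit (X k)) : ∃ X ∈ W, ∀ k ∈ s, IsUnit (X k) := by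
  induction s, hs using Set.Finite.induction_on with
  | empty => exact ⟨0, W.zero_mem, by simp⟩
  | @insert a s _ hs ih =>
    obtain ⟨X, hX, hXs⟩ := ih fun k hk => h k (Set.mem_insert_of_mem a hk)
    obtain ⟨Y, hY, hYa⟩ := h a (Set.mem_insert a s)
    have hpoly : ∀ k, ∃ P : Polynomial 𝕜, (∀ t, P.eval t = (t • X k + Y k).det) ∧
        (IsUnit (X k) ∨ IsUnit (Y k) → P ≠ 0) := by
      intro k
      -- The determinant of `t X k + Y k` is a polynomial in `t` whose coefficient in degree `card
      -- n` is `det (X k)` and whose constant term is `det (Y k)`; it is nonzero as soon as either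
      -- matrix is invertible.
      refine ⟨((Polynomial.X : Polynomial 𝕜) • (X k).map Polynomial.C +
        (Y k).map Polynomial.C).det, fun t => ?_, ?_⟩
      · rw [← Polynomial.coe_evalRingHom, RingHom.map_det]
        congr 1
        ext i j
        simp
        exact mul_comm _ _
      · rintro (h | h) h0 <;> rw [Matrix.isUnit_iff_isUnit_det] at h <;> apply h.ne_zero
        · rw [← Polynomial.coeff_det_X_add_C_card (X k) (Y k), h0, Polynomial.coeff_zero]
        · rw [← Polynomial.coeff_det_X_add_C_zero (X k) (Y k), h0, Polynomial.coeff_zero]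
    choose P hP hP0 using hpoly
    have hprod : (∏ k ∈ hs.toFinset, P k) * P a ≠ 0 :=
      mul_ne_zero (Finset.prod_ne_zero_iff.2 fun k hk => hP0 k (Or.inl (hXs k (by simpa using hk))))
        (hP0 a (Or.inr hYa))
    -- Over an infinite field one `t` avoids the roots of all these finitely many nonzero
    -- polynomials at once.
    obtain ⟨t, ht⟩ : ∃ t, ((∏ k ∈ hs.toFinset, P k) * P a).eval t ≠ 0 := by
      by_contra! hcon
      exact hprod (Polynomial.funext fun t => by rw [hcon t, Polynomial.eval_zero])
    rw [Polynomial.eval_mul, Polynomial.eval_prod] at ht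
    refine ⟨t • X + Y, W.add_mem (W.smul_mem t hX) hY, fun k hk => ?_⟩
    rw [Matrix.isUnit_iff_isUnit_det, isUnit_iff_ne_zero]
    have : (t • X + Y) k = t • X k + Y k := rfl
    rw [this, ← hP]
    rcases hk with rfl | hk
    · exact right_ne_zero_of_mul ht
    · exact Finset.prod_ne_zero_iff.1 (left_ne_zero_of_mul ht) k (by simpa using hk)

end FBI

end

theorem mainTheorem4 (N M nx ny : ℕ) (L : FBI.MoireLattice) (S : FBI.FlatBands L N M)
    (Vhat : FBI.Plane → ℝ)
    (hV_radial : ∀ p q : FBI.Plane, ‖p‖ = ‖q‖ → Vhat p = Vhat q)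
    (hV_pos : ∀ q, 0 < Vhat q)
    -- the series that defines the FBI Hamiltonian converges
    (hH : Summable fun q : L.momenta nx ny => FBI.fbiTerm nx ny S Vhat q)
    (hff : FBI.IsFrustrationFree nx ny S Vhat)
    (hgrid : S.GridConnected nx ny) :
    ∃ B : FBI.Plane → FBI.Plane → Matrix (Fin (2 * M)) (Fin (2 * M)) ℂ,
      (∀ k ∈ L.grid nx ny, ∀ q, IsUnit (B k q)) ∧
      (∀ Ψ, FBI.IsHartreeFockGroundState nx ny S Vhat Ψ →
        ∀ k₁ ∈ L.grid nx ny, ∀ k₂ ∈ L.grid nx ny, ∀ q ∈ L.momenta nx ny,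
          FBI.rdm L nx ny Ψ (k₁ + q) (k₂ + q) =
            (B k₁ q)⁻¹ * FBI.rdm L nx ny Ψ k₁ k₂ * B k₂ q) ∧
      (∀ Ψ Ψ', FBI.IsHartreeFockGroundState nx ny S Vhat Ψ →
        FBI.IsHartreeFockGroundState nx ny S Vhat Ψ' →
        ∀ k₁ ∈ L.grid nx ny, ∀ k₂ ∈ L.grid nx ny,
          FBI.rdm L nx ny Ψ k₁ k₂ = FBI.rdm L nx ny Ψ' k₁ k₂ →
          ∀ q ∈ L.momenta nx ny,
            FBI.rdm L nx ny Ψ (k₁ + q) (k₂ + q) = FBI.rdm L nx ny Ψ' (k₁ + q) (k₂ + q)) := by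
  have hpos : ∀ {k}, k ∈ L.grid nx ny → 0 < nx ∧ 0 < ny := by
    rintro _ ⟨κ, rfl⟩
    exact ⟨Fin.pos κ.1, Fin.pos κ.2⟩
  have hex : ∀ q, ∃ X : FBI.Plane → Matrix (Fin (2 * M)) (Fin (2 * M)) ℂ,
      (∀ k ∈ L.grid nx ny, IsUnit (X k)) ∧
        (q ∈ L.momenta nx ny → X ∈ FBI.intertwiners nx ny S q) := by
    intro q
    by_cases hq : q ∈ L.momenta nx ny
    · obtain ⟨X, hX, hu⟩ := FBI.exists_mem_forall_isUnit (FBI.intertwiners nx ny S q)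
        (Set.finite_range _) fun k (hk : k ∈ L.grid nx ny) =>
          FBI.exists_intertwiner_isUnit S (hpos hk).1 (hpos hk).2 hgrid hq hk
      exact ⟨X, hu, fun _ => hX⟩
    -- Outside `𝒦 + Γ*` only invertibility is required, so the identity serves.
    · exact ⟨fun _ => 1, fun _ _ => isUnit_one, fun h => absurd h hq⟩
  choose X hu hX using hex
  have hrdm : ∀ Ψ, FBI.IsHartreeFockGroundState nx ny S Vhat Ψ →
      ∀ k₁ ∈ L.grid nx ny, ∀ k₂ ∈ L.grid nx ny, ∀ q ∈ L.momenta nx ny,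
        FBI.rdm L nx ny Ψ (k₁ + q) (k₂ + q) =
          (X q k₁)⁻¹ * FBI.rdm L nx ny Ψ k₁ k₂ * X q k₂ := by
    intro Ψ hΨ k₁ h₁ k₂ h₂ q hq
    have h := hX q hq Ψ (fun p hp => FBI.rhoHat_apply_eq_zero S Vhat (hpos h₁).1 (hpos h₁).2
      hV_pos hH hff hΨ.2 hp) k₁ (L.grid_subset_momenta h₁) k₂ (L.grid_subset_momenta h₂)
    rw [mul_assoc, ← h, ← mul_assoc,
      Matrix.nonsing_inv_mul _ ((Matrix.isUnit_iff_isUnit_det _).1 (hu q k₁ h₁)), one_mul]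
  refine ⟨fun k q => X q k, fun k hk q => hu q k hk, hrdm, ?_⟩
  intro Ψ Ψ' hΨ hΨ' k₁ h₁ k₂ h₂ h q hq
  rw [hrdm Ψ hΨ k₁ h₁ k₂ h₂ q hq, hrdm Ψ' hΨ' k₁ h₁ k₂ h₂ q hq, h]
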